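/- Let $k\ge 1$, $n\ge 0$ and let $M$ be a smooth (Hausdorff, $\sigma$-compact) manifold of dimension $n(k+1)$ with a $k$-symplectic structure: closed smooth $2$-forms $\omega_1,\dots,\omega_k$ and an $nk$-dimensional foliation $\mathcal F$ such that $\bigcap_{\alpha} C_x(\omega_\alpha)=\{0\}$ for all $x\in M$ and $\omega_\alpha(X,X')=0$ for all $X,X'\in\Gamma(T\mathcal F)$ and all $\alpha$, where $C_x(\omega)=\{v\in T_xM:\omega_x(v,w)=0\ \forall w\in T_xM\}$. Put $L_\alpha:=T\mathcal F\cap\bigcap_{\beta\ne\alpha}C(\omega_\beta)$ (for $k\ge2$ this equals $\bigcap_{\beta\neq\alpha}C(\omega_\beta)$; for $k=1$ it is $T\mathcal F$). Let $Q$ be a smooth integrable distribution of rank $n$ with $TM=T\mathcal F\oplus Q$ such that, for all $\alpha$, (i) $\omega_\alpha(Y,Y')=0$ for $Y,Y'\in\Gamma(Q)$; (ii) $[X,Y]\in\Gamma(L_\alpha\oplus Q)$ for $X\in\Gamma(L_\alpha)$, $Y\in\Gamma(Q)$; (iii) for all $Y,Y'\in\Gamma(Q)$ there is a single $Z\in\Gamma(Q)$,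 independent of $\alpha$, with $\omega_\alpha(Z,X)=Y(\omega_\alpha(Y',X))-\omega_\alpha(Y',[Y,X])$ for every $\alpha$ and every $X\in\Gamma(L_\alpha)$. A *canonical connection* of $(M,\omega_\alpha,\mathcal F,Q)$ is a smooth linear connection $\nabla$ on $M$ such that $\nabla L_\alpha\subset L_\alpha$ and $\nabla\omega_\alpha=0$ for every $\alpha$, $\nabla Q\subset Q$, and whose torsion satisfies $T(X,Y)=0$ for all $X\in\Gamma(T\mathcal F)$, $Y\in\Gamma(Q)$. Let $g$ be a smooth Riemannian metric and $J_1,\dots,J_k$ smooth endomorphism fields of $TM$ such that $L_1,\dots,L_k,Q$ are mutually $g$-orthogonal and, for every $\alpha$: $L_\alpha=T\mathcal F\cap\bigcap_{\beta\ne\alpha}\ker J_\beta$; $J_\alpha^2=-I$ on $L_\alpha\oplus Q$, $J_\alpha L_\alpha=Q$ and $J_\alpha Q=L_\alpha$; and $\omega_\alpha(X,Y)=g(X,J_\alpha Y)$ for all $X,Y\in\Gamma(TM)$. Suppose that $(M,\omega_\alpha,\mathcal F,J_\alpha,g)$ is $k$-Kähler, that is, for every $\alpha$ the leaves of the foliation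 $L_\alpha\oplus Q$ are Kähler with respect to $J_\alpha$ and $g$: $[J_\alpha X,J_\alpha Y]-J_\alpha[J_\alpha X,Y]-J_\alpha[X,J_\alpha Y]+J_\alpha^2[X,Y]=0$ for all $X,Y\in\Gamma(L_\alpha\oplus Q)$. **Theorem.** If the Levi-Civita connection $\nabla^g$ of $g$ preserves every $L_\alpha$, then it also preserves $Q$, and it coincides with the canonical connection: $\nabla^g$ is a canonical connection of $(M,\omega_\alpha,\mathcal F,Q)$, and every canonical connection of $(M,\omega_\alpha,\mathcal F,Q)$ equals $\nabla^g$. -/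

import Mathlib

open scoped Manifold ContDiff Bundle

noncomputable section

namespace KSymplectic

section General

variable {d : ℕ} (M : Type*) [TopologicalSpace M] [ChartedSpace (EuclideanSpace ℝ (Fin d)) M]

/-- A (not necessarily smooth) vector field on the `d`-dimensional manifold `M`. -/
abbrev Field : Type _ := ∀ x : M, TangentSpace (𝓡 d) x

/-- A field of linear subspaces of the tangent spaces of `M`. -/
abbrev Distribution : Type _ := ∀ x : M, Submodule ℝ (TangentSpace (𝓡 d) x)

variable [IsManifold (𝓡 d) ∞ M]

/-- A linear connection on `M`: a covariant derivative on the tangent bundle.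
`cov Y x v` is `∇_v Y` for `v ∈ T_x M`. Smoothness is the class
`CovariantDerivative.ContMDiffCovariantDerivative cov ∞`. -/
abbrev Connection : Type _ :=
  CovariantDerivative (𝓡 d) (EuclideanSpace ℝ (Fin d)) (fun x : M => TangentSpace (𝓡 d) x)

/-- A smooth Riemannian metric on `M`. -/
abbrev Metric : Type _ :=
  Bundle.ContMDiffRiemannianMetric (𝓡 d) ∞ (EuclideanSpace ℝ (Fin d))
    (fun x : M => TangentSpace (𝓡 d) x)

/-- A smooth differential `2`-form on `M`. -/
structure TwoForm where
  /-- The bilinear form on each tangent space. -/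
  form : ∀ x : M, TangentSpace (𝓡 d) x →L[ℝ] TangentSpace (𝓡 d) x →L[ℝ] ℝ
  alternating : ∀ (x : M) (v : TangentSpace (𝓡 d) x), form x v v = 0
  smooth : ContMDiff (𝓡 d)
    ((𝓡 d).prod 𝓘(ℝ, EuclideanSpace ℝ (Fin d) →L[ℝ] EuclideanSpace ℝ (Fin d) →L[ℝ] ℝ)) ∞
    (fun x => Bundle.TotalSpace.mk'
      (EuclideanSpace ℝ (Fin d) →L[ℝ] EuclideanSpace ℝ (Fin d) →L[ℝ] ℝ) x (form x))

/-- A smooth field of endomorphisms of the tangent spaces of `M`. -/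
structure EndoField where
  /-- The endomorphism of each tangent space. -/
  endo : ∀ x : M, TangentSpace (𝓡 d) x →L[ℝ] TangentSpace (𝓡 d) x
  smooth : ContMDiff (𝓡 d)
    ((𝓡 d).prod 𝓘(ℝ, EuclideanSpace ℝ (Fin d) →L[ℝ] EuclideanSpace ℝ (Fin d))) ∞
    (fun x => Bundle.TotalSpace.mk'
      (EuclideanSpace ℝ (Fin d) →L[ℝ] EuclideanSpace ℝ (Fin d)) x (endo x))

variable {M}

/-- `X` is a smooth vector field. -/
def IsSmoothField (X : Field (d := d) M) : Prop :=
  ContMDiff (𝓡 d) (𝓡 d).tangent ∞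
    (fun x => (Bundle.TotalSpace.mk' (EuclideanSpace ℝ (Fin d)) x (X x) : TangentBundle (𝓡 d) M))

/-- `X ∈ Γ(D)`: a smooth vector field with values in `D`. -/
def IsSection (D : Distribution (d := d) M) (X : Field (d := d) M) : Prop :=
  IsSmoothField X ∧ ∀ x, X x ∈ D x

/-- The Lie bracket `[X, Y]`. -/
abbrev bracket (X Y : Field (d := d) M) : Field (d := d) M :=
  VectorField.mlieBracket (𝓡 d) X Y

/-- The directional derivative `v(f)` of a function `f` along `v ∈ T_x M`. -/
abbrev dirDeriv (f : M → ℝ) (x : M) (v : TangentSpace (𝓡 d) x) : ℝ :=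
  mvfderiv (𝓡 d) f x v

/-- `D` is a smooth distribution of rank `r`, that is a smooth subbundle of `TM`: its rank is
constant and each of its vectors is the value of a smooth section. -/
structure IsSmoothDistribution (r : ℕ) (D : Distribution (d := d) M) : Prop where
  rank : ∀ x, Module.finrank ℝ (D x) = r
  exists_section : ∀ x, ∀ v ∈ D x, ∃ X : Field (d := d) M, IsSection D X ∧ X x = v

/-- `D` is integrable (involutive): `[X, Y] ∈ Γ(D)` for all `X, Y ∈ Γ(D)`. -/
def IsInvolutive (D : Distribution (d := d) M) : Prop :=
  ∀ X Y : Field (d := d) M, IsSection D X → IsSection D Y → ∀ x, bracket X Y x ∈ D x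

/-- `C_x(η) = {v ∈ T_x M : η_x(v, w) = 0 for all w}`. -/
def TwoForm.char (η : TwoForm (d := d) M) : Distribution (d := d) M :=
  fun x => LinearMap.ker (η.form x).toLinearMap

/-- `dη = 0`, where `dη` is given by the invariant formula. -/
def TwoForm.IsClosed (η : TwoForm (d := d) M) : Prop :=
  ∀ X Y Z : Field (d := d) M, IsSmoothField X → IsSmoothField Y → IsSmoothField Z → ∀ x,
    dirDeriv (fun y => η.form y (Y y) (Z y)) x (X x)
      - dirDeriv (fun y => η.form y (X y) (Z y)) x (Y x)
      + dirDeriv (fun y => η.form y (X y) (Y y)) x (Z x)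
      - η.form x (bracket X Y x) (Z x)
      + η.form x (bracket X Z x) (Y x)
      - η.form x (bracket Y Z x) (X x) = 0

/-- `[J, J](X, Y) = [JX, JY] - J[JX, Y] - J[X, JY] + J²[X, Y]`. -/
def EndoField.nijenhuis (J : EndoField (d := d) M) (X Y : Field (d := d) M) :
    Field (d := d) M :=
  fun x =>
    bracket (fun y => J.endo y (X y)) (fun y => J.endo y (Y y)) x
      - J.endo x (bracket (fun y => J.endo y (X y)) Y x)
      - J.endo x (bracket X (fun y => J.endo y (Y y)) x)
      + J.endo x (J.endo x (bracket X Y x))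

/-- `∇ D ⊂ D`: `∇_v X ∈ D` for every `X ∈ Γ(D)` and every tangent vector `v`. -/
def Preserves (cov : Connection (d := d) M) (D : Distribution (d := d) M) : Prop :=
  ∀ X : Field (d := d) M, IsSection D X → ∀ x (v : TangentSpace (𝓡 d) x), cov X x v ∈ D x

/-- `∇η = 0`. -/
def IsParallel (cov : Connection (d := d) M) (η : TwoForm (d := d) M) : Prop :=
  ∀ X Y : Field (d := d) M, IsSmoothField X → IsSmoothField Y →
    ∀ x (v : TangentSpace (𝓡 d) x),
      dirDeriv (fun y => η.form y (X y) (Y y)) x v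
        = η.form x (cov X x v) (Y x) + η.form x (X x) (cov Y x v)

/-- `cov` is the Levi-Civita connection of `g`: the smooth torsion-free connection for which
`g` is parallel. -/
structure IsLeviCivita (g : Metric (d := d) M) (cov : Connection (d := d) M) : Prop where
  smooth : CovariantDerivative.ContMDiffCovariantDerivative cov ∞
  torsion_free : cov.torsion = 0
  metric :
    letI : Bundle.RiemannianBundle (fun x : M => TangentSpace (𝓡 d) x) := ⟨g.toRiemannianMetric⟩
    cov.IsMetricCompatible

/-- Two connections coincide. (Mathlib's covariant derivatives also take values on fields that
are not differentiable; these carry no information and are not compared.) -/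
def Coincide (cov cov' : Connection (d := d) M) : Prop :=
  ∀ (Y : Field (d := d) M) (x : M),
    MDifferentiableAt (𝓡 d) (𝓡 d).tangent
      (fun y => (Bundle.TotalSpace.mk' (EuclideanSpace ℝ (Fin d)) y (Y y) :
        TangentBundle (𝓡 d) M)) x →
    cov Y x = cov' Y x

end General

/-- A `k`-symplectic structure on the `n(k+1)`-dimensional manifold `M`. The `nk`-dimensional
foliation is given by its tangent distribution `F`. -/
structure KSymplecticStructure (n k : ℕ) (M : Type*) [TopologicalSpace M]
    [ChartedSpace (EuclideanSpace ℝ (Fin (n * (k + 1)))) M]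
    [IsManifold (𝓡 (n * (k + 1))) ∞ M] where
  /-- The `2`-forms `ω_1, …, ω_k`. -/
  Ω : Fin k → TwoForm (d := n * (k + 1)) M
  /-- The tangent distribution of the foliation. -/
  F : Distribution (d := n * (k + 1)) M
  closed : ∀ α, (Ω α).IsClosed
  smooth_F : IsSmoothDistribution (n * k) F
  involutive_F : IsInvolutive F
  char_inf : ∀ x, ⨅ α, (Ω α).char x = ⊥
  isotropic_F : ∀ α x, ∀ v ∈ F x, ∀ w ∈ F x, (Ω α).form x v w = 0

section KSymp

variable {n k : ℕ} {M : Type*} [TopologicalSpace M]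
  [ChartedSpace (EuclideanSpace ℝ (Fin (n * (k + 1)))) M]
  [IsManifold (𝓡 (n * (k + 1))) ∞ M]

/-- `L_α = TF ∩ ⋂_{β ≠ α} C(ω_β)`. For `k ≥ 2` the intersection of the `C(ω_β)` already lies in
`TF` (see `KSymplecticStructure.L_eq`); for `k = 1` this is `L_1 = TF`. -/
def KSymplecticStructure.L (S : KSymplecticStructure n k M) (α : Fin k) :
    Distribution (d := n * (k + 1)) M :=
  fun x => S.F x ⊓ ⨅ β, ⨅ (_ : β ≠ α), (S.Ω β).char x

/-- The linear algebra behind `KSymplecticStructure.L_eq`. -/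
theorem iInf_ker_le {V : Type*} [AddCommGroup V] [Module ℝ V] [FiniteDimensional ℝ V]
    {n k : ℕ} (hdim : Module.finrank ℝ V = n * (k + 1)) (F : Submodule ℝ V)
    (hF : Module.finrank ℝ F = n * k) (η : Fin k → V →ₗ[ℝ] V →ₗ[ℝ] ℝ)
    (halt : ∀ β u, η β u u = 0) (hiso : ∀ β, ∀ u ∈ F, ∀ w ∈ F, η β u w = 0)
    (hchar : ∀ u, (∀ β, η β u = 0) → u = 0) (hk : 2 ≤ k) (α : Fin k) (v : V)
    (hv : ∀ β, β ≠ α → η β v = 0) : v ∈ F := by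
  have hanti : ∀ β (u w : V), η β u w = -(η β w u) := by
    intro β u w
    have h := halt β (u + w)
    simp only [map_add, LinearMap.add_apply, halt] at h
    linarith
  let b : Fin k → F →ₗ[ℝ] Module.Dual ℝ (V ⧸ F) := fun β =>
    { toFun := fun u => F.liftQ (η β u) fun w hw => hiso β u u.2 w hw
      map_add' := fun _ _ => Submodule.linearMap_qext _ (LinearMap.ext fun _ => by simp; rfl)
      map_smul' := fun _ _ => Submodule.linearMap_qext _ (LinearMap.ext fun _ => by simp; exact Or.inl rfl) }
  have hb : ∀ β u w, b β u (Submodule.Quotient.mk w) = η β u w := fun _ _ _ => rfl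
  let Φ : F →ₗ[ℝ] (Fin k → Module.Dual ℝ (V ⧸ F)) := LinearMap.pi b
  have hinj : Function.Injective Φ := by
    refine (injective_iff_map_eq_zero Φ).mpr fun u hu => Subtype.ext (hchar u fun β => ?_)
    refine LinearMap.ext fun w => ?_
    have h := hb β u w
    rw [show b β u = 0 from congrFun hu β] at h
    exact h.symm
  have hrank : Module.finrank ℝ (V ⧸ F) = n := by
    have h := Submodule.finrank_quotient_add_finrank F
    rw [hF, hdim] at h
    linarith
  have hsurj : Function.Surjective Φ := by
    refine (LinearMap.injective_iff_surjective_of_finrank_eq_finrank ?_).mp hinj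
    rw [Module.finrank_pi_fintype, hF]
    simp [Subspace.dual_finrank_eq, hrank, mul_comm]
  obtain ⟨β, hβ⟩ : ∃ β : Fin k, β ≠ α := by
    have : Nontrivial (Fin k) := Fin.nontrivial_iff_two_le.mpr hk
    exact exists_ne α
  refine (Submodule.Quotient.mk_eq_zero F).mp
    ((Module.forall_dual_apply_eq_zero_iff ℝ _).mp fun φ => ?_)
  obtain ⟨u, hu⟩ := hsurj (fun _ => φ)
  have h := hb β u v
  rw [show b β u = φ from congrFun hu β, hanti β u v, hv β hβ] at h
  simpa using h

/-- For `k ≥ 2` the distribution `L_α` is `⋂_{β ≠ α} C(ω_β)`. -/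
theorem KSymplecticStructure.L_eq (S : KSymplecticStructure n k M) (hk : 2 ≤ k) (α : Fin k)
    (x : M) : S.L α x = ⨅ β, ⨅ (_ : β ≠ α), (S.Ω β).char x := by
  refine inf_eq_right.mpr fun v hv => ?_
  have hfin : FiniteDimensional ℝ (TangentSpace (𝓡 (n * (k + 1))) x) :=
    inferInstanceAs (FiniteDimensional ℝ (EuclideanSpace ℝ (Fin (n * (k + 1)))))
  have hdim : Module.finrank ℝ (TangentSpace (𝓡 (n * (k + 1))) x) = n * (k + 1) :=
    finrank_euclideanSpace_fin
  refine iInf_ker_le hdim (S.F x) (S.smooth_F.rank x)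
    (fun β => ContinuousLinearMap.coeLM ℝ ∘ₗ ((S.Ω β).form x).toLinearMap)
    (fun β u => (S.Ω β).alternating x u) (fun β u hu w hw => S.isotropic_F β x u hu w hw)
    (fun u hu => ?_) hk α v (fun β hβ => ?_)
  · have h : u ∈ ⨅ β, (S.Ω β).char x := (Submodule.mem_iInf _).mpr fun β =>
      LinearMap.mem_ker.mpr (ContinuousLinearMap.ext fun w => LinearMap.congr_fun (hu β) w)
    rw [S.char_inf x] at h
    exact (Submodule.mem_bot ℝ).mp h
  · have h : v ∈ (S.Ω β).char x :=
      (Submodule.mem_iInf _).mp ((Submodule.mem_iInf _).mp hv β) hβ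
    have h' : (S.Ω β).form x v = 0 := LinearMap.mem_ker.mp h
    exact LinearMap.ext fun w => congrArg (fun f => f w) h'

/-- The distribution `L_α ⊕ Q`. -/
def KSymplecticStructure.LQ (S : KSymplecticStructure n k M)
    (Q : Distribution (d := n * (k + 1)) M) (α : Fin k) : Distribution (d := n * (k + 1)) M :=
  fun x => S.L α x ⊔ Q x

/-- The assumptions on the transversal distribution `Q` under which the canonical connection is
defined. -/
structure IsAdmissible (S : KSymplecticStructure n k M)
    (Q : Distribution (d := n * (k + 1)) M) : Prop where
  smooth : IsSmoothDistribution n Q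
  involutive : IsInvolutive Q
  transversal : ∀ x, IsCompl (S.F x) (Q x)
  isotropic : ∀ α x, ∀ v ∈ Q x, ∀ w ∈ Q x, (S.Ω α).form x v w = 0
  bracket_mem : ∀ α, ∀ X Y : Field (d := n * (k + 1)) M, IsSection (S.L α) X → IsSection Q Y →
    ∀ x, bracket X Y x ∈ S.LQ Q α x
  /-- The sections `(i_α^*)⁻¹(ψ_α^{Y Y'})` of `Q` agree for all `α`, where
  `i_α^* : Q → L_α^*` is `Z ↦ ω_α(Z, ·)` and
  `ψ_α^{Y Y'}(X) = Y(ω_α(Y', X)) - ω_α(Y', [Y, X])`: call `Z` their common value. -/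
  psi_agree : ∀ Y Y' : Field (d := n * (k + 1)) M, IsSection Q Y → IsSection Q Y' →
    ∃ Z : Field (d := n * (k + 1)) M, IsSection Q Z ∧
      ∀ α, ∀ X : Field (d := n * (k + 1)) M, IsSection (S.L α) X → ∀ x,
        (S.Ω α).form x (Z x) (X x)
          = dirDeriv (fun y => (S.Ω α).form y (Y' y) (X y)) x (Y x)
            - (S.Ω α).form x (Y' x) (bracket Y X x)

/-- `cov` is a canonical connection of `(S, Q)`: a smooth connection that preserves every `L_α`
and `Q`, for which every `ω_α` is parallel, and with `T(X, Y) = 0` for `X ∈ TF`, `Y ∈ Q`. -/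
structure IsCanonicalConnection (S : KSymplecticStructure n k M)
    (Q : Distribution (d := n * (k + 1)) M) (cov : Connection (d := n * (k + 1)) M) : Prop where
  smooth : CovariantDerivative.ContMDiffCovariantDerivative cov ∞
  preserves_L : ∀ α, Preserves cov (S.L α)
  preserves_Q : Preserves cov Q
  parallel : ∀ α, IsParallel cov (S.Ω α)
  torsion : ∀ x, ∀ v ∈ S.F x, ∀ w ∈ Q x, cov.torsion x v w = 0

/-- `(J_1, …, J_k, g)` is a compatible almost `k`-Kähler structure. -/
structure IsAlmostKKahler (S : KSymplecticStructure n k M)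
    (Q : Distribution (d := n * (k + 1)) M) (J : Fin k → EndoField (d := n * (k + 1)) M)
    (g : Metric (d := n * (k + 1)) M) : Prop where
  orthogonal_L : ∀ α β, α ≠ β → ∀ x, ∀ v ∈ S.L α x, ∀ w ∈ S.L β x, g.inner x v w = 0
  orthogonal_Q : ∀ α x, ∀ v ∈ S.L α x, ∀ w ∈ Q x, g.inner x v w = 0
  /-- `L_α = TF ∩ ⋂_{β ≠ α} ker J_β`; again `TF` matters only for `k = 1`. -/
  L_eq_ker : ∀ α x,
    S.L α x = S.F x ⊓ ⨅ β, ⨅ (_ : β ≠ α), LinearMap.ker ((J β).endo x).toLinearMap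
  sq_eq_neg : ∀ α x, ∀ v ∈ S.LQ Q α x, (J α).endo x ((J α).endo x v) = -v
  map_L : ∀ α x, (S.L α x).map ((J α).endo x).toLinearMap = Q x
  map_Q : ∀ α x, (Q x).map ((J α).endo x).toLinearMap = S.L α x
  compatible : ∀ α x (v w : TangentSpace (𝓡 (n * (k + 1))) x),
    (S.Ω α).form x v w = g.inner x v ((J α).endo x w)

/-- `(M, ω_α, F, J_α, g)`, with the transversal distribution `Q`, is a `k`-Kähler manifold:
each `[J_α, J_α]` vanishes on the leaves of `L_α ⊕ Q`, that is, these leaves are Kähler. -/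
structure IsKKahler (S : KSymplecticStructure n k M)
    (Q : Distribution (d := n * (k + 1)) M) (J : Fin k → EndoField (d := n * (k + 1)) M)
    (g : Metric (d := n * (k + 1)) M) : Prop extends IsAdmissible S Q, IsAlmostKKahler S Q J g where
  nijenhuis_eq_zero : ∀ α, ∀ X Y : Field (d := n * (k + 1)) M,
    IsSection (S.LQ Q α) X → IsSection (S.LQ Q α) Y → ∀ x, (J α).nijenhuis X Y x = 0

end KSymp

end KSymplectic

end

noncomputable section

namespace KSymplectic

section General

variable {d : ℕ} {M : Type*} [TopologicalSpace M] [ChartedSpace (EuclideanSpace ℝ (Fin d)) M]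

/-! Pointwise, `TM` is spanned by the `L_α` and `Q`, and `Q` is the orthogonal complement of the
`L_α`; a metric connection preserving every `L_α` therefore preserves `Q`. As `∇^g` is torsion-free,
only `∇ω_α = 0` remains for it to be canonical.

The tensor `∇ω_α` (`derivForm`) is checked on pairs of summands. It vanishes when one argument lies
in `L_β`, `β ≠ α`, because `L_β` is preserved and lies in `C(ω_α)`, and on `L_α × L_α` and `Q × Q`,
because both are preserved and isotropic. The heart is `L_α × Q`. For `D = L_α` or `D = Q` put `A(X,
Y, Z) = (∇_Z ω_α)(X, J_α Y)` on `D`. Metric compatibility makes `A` skew in `X, Y`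
(`derivForm_endo_skew`); closedness and isotropy of `D` make it symmetric in `X, Z`; so `A = 0`
(`derivForm_endo_eq_zero`). Directions in `L_β`, `β ≠ α`, follow from closedness.

For uniqueness, let `A` be the difference of two canonical connections. The torsion condition
equates a vector of `L_α` with one of `Q`, so `A` has no mixed terms; the pairings of `L_α` with `Q`
by `ω_α`, for which `A` is skew, remove the rest. -/

instance finiteDimensional_tangentSpace (x : M) : FiniteDimensional ℝ (TangentSpace (𝓡 d) x) :=
  inferInstanceAs (FiniteDimensional ℝ (EuclideanSpace ℝ (Fin d)))

/-- A subspace whose orthogonal with respect to a bilinear form is trivial is the whole space. -/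
theorem eq_top_of_orthogonal_eq_zero {V : Type*} [AddCommGroup V] [Module ℝ V]
    [FiniteDimensional ℝ V] (B : V →ₗ[ℝ] V →ₗ[ℝ] ℝ) (W : Submodule ℝ V)
    (h : ∀ u, (∀ w ∈ W, B u w = 0) → u = 0) : W = ⊤ := by
  -- The map `V → W^*` induced by `B` is injective, hence `dim V ≤ dim W`.
  let Φ : V →ₗ[ℝ] Module.Dual ℝ W := (LinearMap.lcomp ℝ ℝ W.subtype) ∘ₗ B
  have hΦ : Function.Injective Φ := (injective_iff_map_eq_zero Φ).mpr fun u hu =>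
    h u fun w hw => LinearMap.congr_fun hu ⟨w, hw⟩
  refine Submodule.eq_top_of_finrank_eq (le_antisymm (Submodule.finrank_le W) ?_)
  simpa [Subspace.dual_finrank_eq] using LinearMap.finrank_le_finrank_of_injective hΦ

variable [IsManifold (𝓡 d) ∞ M]

theorem IsSmoothField.mdifferentiableAt {X : Field (d := d) M} (hX : IsSmoothField X) (x : M) :
    MDifferentiableAt (𝓡 d) (𝓡 d).tangent
      (fun y => (Bundle.TotalSpace.mk' (EuclideanSpace ℝ (Fin d)) y (X y) :
        TangentBundle (𝓡 d) M)) x :=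
  (hX x).mdifferentiableAt (by simp)

theorem EndoField.isSmoothField_apply (J : EndoField (d := d) M) {X : Field (d := d) M}
    (hX : IsSmoothField X) : IsSmoothField fun y => J.endo y (X y) :=
  ContMDiff.clm_bundle_apply (b := id) J.smooth hX

theorem TwoForm.form_swap (η : TwoForm (d := d) M) (x : M) (u w : TangentSpace (𝓡 d) x) :
    η.form x u w = -η.form x w u := by
  have h := η.alternating x (u + w)
  simp only [map_add, add_apply, η.alternating] at h
  linarith

theorem TwoForm.form_eq_zero_of_mem_char (η : TwoForm (d := d) M) {x : M}
    {u : TangentSpace (𝓡 d) x} (hu : u ∈ η.char x) (w : TangentSpace (𝓡 d) x) :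
    η.form x u w = 0 := by
  have h : η.form x u = 0 := LinearMap.mem_ker.mp hu
  rw [h]; rfl

theorem TwoForm.mdifferentiableAt_apply (η : TwoForm (d := d) M) {X Y : Field (d := d) M} {x : M}
    (hX : MDifferentiableAt (𝓡 d) (𝓡 d).tangent
      (fun y => (Bundle.TotalSpace.mk' (EuclideanSpace ℝ (Fin d)) y (X y) :
        TangentBundle (𝓡 d) M)) x)
    (hY : MDifferentiableAt (𝓡 d) (𝓡 d).tangent
      (fun y => (Bundle.TotalSpace.mk' (EuclideanSpace ℝ (Fin d)) y (Y y) :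
        TangentBundle (𝓡 d) M)) x) :
    MDifferentiableAt (𝓡 d) 𝓘(ℝ, ℝ) (fun y => η.form y (X y) (Y y)) x := by
  have h : MDifferentiableAt (𝓡 d) ((𝓡 d).prod 𝓘(ℝ, ℝ))
      (fun y => Bundle.TotalSpace.mk' ℝ (E := Bundle.Trivial M ℝ) y (η.form y (X y) (Y y))) x :=
    MDifferentiableAt.clm_bundle_apply₂ (b := id) (E₃ := Bundle.Trivial M ℝ)
      ((η.smooth x).mdifferentiableAt (by simp)) hX hY
  exact ((mdifferentiableAt_totalSpace _ _).mp h).2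

/-! ### The covariant derivative of a two-form as a tensor -/

/-- `(X, Y) ↦ (v ↦ v(η(X, Y)) - η(∇_v X, Y) - η(X, ∇_v Y))` on vector fields. -/
def derivFormAux (cov : Connection (d := d) M) (η : TwoForm (d := d) M)
    (X Y : Field (d := d) M) (x : M) : TangentSpace (𝓡 d) x →L[ℝ] ℝ :=
  mvfderiv (𝓡 d) (fun y => η.form y (X y) (Y y)) x
    -- The plus sign comes from `-η(∇_v X, Y) = η(Y, ∇_v X)`, which makes the term a composite of
    -- linear maps in `v`.
    + (η.form x (Y x)) ∘L cov X x - (η.form x (X x)) ∘L cov Y x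

theorem derivFormAux_apply (cov : Connection (d := d) M) (η : TwoForm (d := d) M)
    (X Y : Field (d := d) M) (x : M) (v : TangentSpace (𝓡 d) x) :
    derivFormAux cov η X Y x v = dirDeriv (fun y => η.form y (X y) (Y y)) x v
      - η.form x (cov X x v) (Y x) - η.form x (X x) (cov Y x v) := by
  rw [η.form_swap x (cov X x v), sub_neg_eq_add]
  rfl

theorem tensorialAt_derivFormAux_left (cov : Connection (d := d) M) (η : TwoForm (d := d) M)
    (x : M) (Y : Field (d := d) M)
    (hY : MDifferentiableAt (𝓡 d) (𝓡 d).tangent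
      (fun y => (Bundle.TotalSpace.mk' (EuclideanSpace ℝ (Fin d)) y (Y y) :
        TangentBundle (𝓡 d) M)) x) :
    TensorialAt (𝓡 d) (EuclideanSpace ℝ (Fin d)) (derivFormAux cov η · Y x) x where
  smul {f X} hf hX := by
    ext v
    simp [derivFormAux, mvfderiv_fun_mul hf (η.mdifferentiableAt_apply hX hY),
      cov.isCovariantDerivativeOn.leibniz hX hf]
    -- The Leibniz terms leave `v(f) (η(X, Y) + η(Y, X))`, which is zero.
    linear_combination (mvfderiv (𝓡 d) f x v) * η.form_swap x (X x) (Y x)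
  add hX hX' := by
    ext v
    simp [derivFormAux, mvfderiv_fun_add (η.mdifferentiableAt_apply hX hY)
      (η.mdifferentiableAt_apply hX' hY), cov.isCovariantDerivativeOn.add hX hX']
    abel

theorem tensorialAt_derivFormAux_right (cov : Connection (d := d) M) (η : TwoForm (d := d) M)
    (x : M) (X : Field (d := d) M)
    (hX : MDifferentiableAt (𝓡 d) (𝓡 d).tangent
      (fun y => (Bundle.TotalSpace.mk' (EuclideanSpace ℝ (Fin d)) y (X y) :
        TangentBundle (𝓡 d) M)) x) :
    TensorialAt (𝓡 d) (EuclideanSpace ℝ (Fin d)) (derivFormAux cov η X · x) x where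
  smul hf hY := by
    ext v
    simp [derivFormAux, mvfderiv_fun_mul hf (η.mdifferentiableAt_apply hX hY),
      cov.isCovariantDerivativeOn.leibniz hY hf]
    ring
  add hY hY' := by
    ext v
    simp [derivFormAux, mvfderiv_fun_add (η.mdifferentiableAt_apply hX hY)
      (η.mdifferentiableAt_apply hX hY'), cov.isCovariantDerivativeOn.add hY hY']
    abel

/-- The covariant derivative of a two-form: `derivForm cov η x u w v = (∇_v η)(u, w)`. -/
def derivForm (cov : Connection (d := d) M) (η : TwoForm (d := d) M) (x : M) :
    TangentSpace (𝓡 d) x →L[ℝ] TangentSpace (𝓡 d) x →L[ℝ] TangentSpace (𝓡 d) x →L[ℝ] ℝ :=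
  TensorialAt.mkHom₂ (derivFormAux cov η · · x) _
    (tensorialAt_derivFormAux_left cov η x) (tensorialAt_derivFormAux_right cov η x)

theorem derivForm_apply (cov : Connection (d := d) M) (η : TwoForm (d := d) M)
    {X Y : Field (d := d) M} (hX : IsSmoothField X) (hY : IsSmoothField Y) (x : M)
    (v : TangentSpace (𝓡 d) x) :
    derivForm cov η x (X x) (Y x) v = dirDeriv (fun y => η.form y (X y) (Y y)) x v
      - η.form x (cov X x v) (Y x) - η.form x (X x) (cov Y x v) := by
  unfold derivForm
  rw [TensorialAt.mkHom₂_apply _ _ (hX.mdifferentiableAt x) (hY.mdifferentiableAt x),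
    derivFormAux_apply]

theorem isParallel_of_derivForm_eq_zero {cov : Connection (d := d) M} {η : TwoForm (d := d) M}
    (h : ∀ x, derivForm cov η x = 0) : IsParallel cov η := by
  intro X Y hX hY x v
  have h' := derivForm_apply cov η hX hY x v
  rw [h x] at h'
  simp only [zero_apply] at h'
  linarith

/-! ### Consequences of metric compatibility, zero torsion and closedness -/

theorem IsLeviCivita.dirDeriv_inner {g : Metric (d := d) M} {cov : Connection (d := d) M}
    (h : IsLeviCivita g cov) {X Y : Field (d := d) M} (hX : IsSmoothField X)
    (hY : IsSmoothField Y) (x : M) (v : TangentSpace (𝓡 d) x) :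
    dirDeriv (fun y => g.inner y (X y) (Y y)) x v
      = g.inner x (cov X x v) (Y x) + g.inner x (X x) (cov Y x v) := by
  let : Bundle.RiemannianBundle (fun x : M => TangentSpace (𝓡 d) x) := ⟨g.toRiemannianMetric⟩
  -- Compatibility is applied along a vector field, so `v` is extended to one; only its value at `x`
  -- matters.
  have h' := h.metric.mvfderiv_inner_eq (FiberBundle.extend (EuclideanSpace ℝ (Fin d)) v)
    (hX.mdifferentiableAt x) (hY.mdifferentiableAt x)
  simp only [FiberBundle.extend_apply_self] at h'
  exact h'

theorem bracket_eq_of_torsion_eq_zero {cov : Connection (d := d) M} {X Y : Field (d := d) M}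
    (hX : IsSmoothField X) (hY : IsSmoothField Y) {x : M} (h : cov.torsion x (X x) (Y x) = 0) :
    bracket X Y x = cov Y x (X x) - cov X x (Y x) := by
  rw [cov.torsion_apply (hX.mdifferentiableAt x) (hY.mdifferentiableAt x)] at h
  exact (sub_eq_zero.mp h).symm

/-- For a torsion-free connection, `dη` is the cyclic sum of `∇η`. -/
theorem TwoForm.IsClosed.cyclic_sum_derivForm {η : TwoForm (d := d) M} (hη : η.IsClosed)
    {cov : Connection (d := d) M} (h : cov.torsion = 0) {X Y Z : Field (d := d) M}
    (hX : IsSmoothField X) (hY : IsSmoothField Y) (hZ : IsSmoothField Z) (x : M) :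
    derivForm cov η x (Y x) (Z x) (X x) + derivForm cov η x (Z x) (X x) (Y x)
      + derivForm cov η x (X x) (Y x) (Z x) = 0 := by
  have hT : ∀ u w, cov.torsion x u w = 0 := fun u w => by rw [h]; rfl
  have hd := hη X Y Z hX hY hZ x
  rw [bracket_eq_of_torsion_eq_zero hX hY (hT _ _), bracket_eq_of_torsion_eq_zero hX hZ (hT _ _),
    bracket_eq_of_torsion_eq_zero hY hZ (hT _ _)] at hd
  simp only [derivForm_apply cov η hX hY, derivForm_apply cov η hY hZ, derivForm_apply cov η hZ hX]
  have hneg : dirDeriv (fun y => η.form y (Z y) (X y)) x (Y x)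
      = -dirDeriv (fun y => η.form y (X y) (Z y)) x (Y x) := by
    have : (fun y => η.form y (Z y) (X y)) = -(fun y => η.form y (X y) (Z y)) :=
      funext fun y => η.form_swap y _ _
    rw [dirDeriv, this, mvfderiv_neg]; rfl
  simp only [map_sub, sub_apply] at hd
  rw [hneg, η.form_swap x (Y x) (cov Z x (X x)), η.form_swap x (Z x) (cov X x (Y x)),
    η.form_swap x (X x) (cov Y x (Z x))]
  linarith

theorem derivForm_swap (cov : Connection (d := d) M) (η : TwoForm (d := d) M)
    {X Y : Field (d := d) M} (hX : IsSmoothField X) (hY : IsSmoothField Y) (x : M)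
    (v : TangentSpace (𝓡 d) x) :
    derivForm cov η x (X x) (Y x) v = -derivForm cov η x (Y x) (X x) v := by
  have : (fun y => η.form y (X y) (Y y)) = -(fun y => η.form y (Y y) (X y)) :=
    funext fun y => η.form_swap y _ _
  rw [derivForm_apply cov η hX hY, derivForm_apply cov η hY hX, dirDeriv, this, mvfderiv_neg,
    η.form_swap x (cov X x v), η.form_swap x (X x)]
  change -(dirDeriv (fun y => η.form y (Y y) (X y)) x v) - _ - _ = _
  ring

/-- If `X`, `Y` are sections of subbundles that are `η`-orthogonal and preserved by `∇`, then
`(∇η)(X, Y) = 0`. -/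
theorem derivForm_eq_zero_of_orthogonal {cov : Connection (d := d) M} {η : TwoForm (d := d) M}
    {D D' : Distribution (d := d) M} (hD : Preserves cov D) (hD' : Preserves cov D')
    (h : ∀ x, ∀ u ∈ D x, ∀ w ∈ D' x, η.form x u w = 0)
    {X Y : Field (d := d) M} (hX : IsSection D X) (hY : IsSection D' Y)
    (x : M) (v : TangentSpace (𝓡 d) x) : derivForm cov η x (X x) (Y x) v = 0 := by
  have h0 : (fun y => η.form y (X y) (Y y)) = 0 := funext fun y => h y _ (hX.2 y) _ (hY.2 y)
  rw [derivForm_apply cov η hX.1 hY.1, dirDeriv, h0, mvfderiv_zero,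
    h x _ (hD X hX x v) _ (hY.2 x), h x _ (hX.2 x) _ (hD' Y hY x v)]
  simp

/-- `∇η` for `η = g(·, J ·)` with `J² = -1` along `X`, `Y`, and `∇g = 0`. -/
theorem IsLeviCivita.derivForm_endo_skew {g : Metric (d := d) M} {cov : Connection (d := d) M}
    (h : IsLeviCivita g cov) {η : TwoForm (d := d) M} {J : EndoField (d := d) M}
    (hη : ∀ x (v w : TangentSpace (𝓡 d) x), η.form x v w = g.inner x v (J.endo x w))
    {X Y : Field (d := d) M} (hX : IsSmoothField X) (hY : IsSmoothField Y)
    (hJX : ∀ x, J.endo x (J.endo x (X x)) = -X x) (hJY : ∀ x, J.endo x (J.endo x (Y x)) = -Y x)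
    (x : M) (v : TangentSpace (𝓡 d) x) :
    derivForm cov η x (X x) (J.endo x (Y x)) v + derivForm cov η x (Y x) (J.endo x (X x)) v = 0 := by
  have hX' := J.isSmoothField_apply hX
  have hY' := J.isSmoothField_apply hY
  have hadj : ∀ y (u w : TangentSpace (𝓡 d) y),
      g.inner y u (J.endo y w) = -g.inner y (J.endo y u) w := fun y u w => by
    rw [← hη, η.form_swap, hη, g.symm]
  have key : ∀ {U W : Field (d := d) M}, IsSmoothField U → IsSmoothField W →
      (∀ x, J.endo x (J.endo x (W x)) = -W x) →
      derivForm cov η x (U x) (J.endo x (W x)) v = - g.inner x (U x) (cov W x v)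
        + g.inner x (J.endo x (U x)) (cov (fun y => J.endo y (W y)) x v) := by
    intro U W hU hW hJW
    have h1 : (fun y => η.form y (U y) (J.endo y (W y))) = -(fun y => g.inner y (U y) (W y)) :=
      funext fun y => by rw [hη, hJW, map_neg]; rfl
    rw [derivForm_apply cov η hU (J.isSmoothField_apply hW), dirDeriv, h1, mvfderiv_neg]
    change -(dirDeriv (fun y => g.inner y (U y) (W y)) x v) - _ - _ = _
    rw [h.dirDeriv_inner hU hW, hη, hη, hJW, hadj x (U x), map_neg]
    ring
  -- `J` is skew-adjoint and squares to `-1` on `X`, so `g(JX, JY) = g(X, Y)`. By `key`, the sum to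
  -- be computed is `v(g(JX, JY)) - v(g(X, Y))`.
  have h1 : (fun y => g.inner y (J.endo y (X y)) (J.endo y (Y y)))
      = fun y => g.inner y (X y) (Y y) :=
    funext fun y => by rw [hadj, hJX, map_neg, neg_apply, neg_neg]
  have h2 := h.dirDeriv_inner hX' hY' x v
  rw [h1, h.dirDeriv_inner hX hY] at h2
  rw [key hX hY hJY, key hY hX hJX, g.symm x (Y x), g.symm x (J.endo x (Y x))]
  linarith

end General

/-! ### Pointwise linear algebra of the splitting into the `L_α` and `Q` -/

section KSymp

variable {n k : ℕ} {M : Type*} [TopologicalSpace M]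
  [ChartedSpace (EuclideanSpace ℝ (Fin (n * (k + 1)))) M]
  [IsManifold (𝓡 (n * (k + 1))) ∞ M]
  {S : KSymplecticStructure n k M} {Q : Distribution (d := n * (k + 1)) M}
  {J : Fin k → EndoField (d := n * (k + 1)) M} {g : Metric (d := n * (k + 1)) M}

theorem KSymplecticStructure.L_le_F (α : Fin k) (x : M) : S.L α x ≤ S.F x := inf_le_left

theorem KSymplecticStructure.L_le_char {α β : Fin k} (h : β ≠ α) (x : M) :
    S.L α x ≤ (S.Ω β).char x :=
  inf_le_right.trans (iInf₂_le β h)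

theorem KSymplecticStructure.eq_zero_of_form_eq_zero {x : M}
    {u : TangentSpace (𝓡 (n * (k + 1))) x} (h : ∀ α w, (S.Ω α).form x u w = 0) : u = 0 := by
  have hu : u ∈ ⨅ α, (S.Ω α).char x := (Submodule.mem_iInf _).mpr fun α =>
    LinearMap.mem_ker.mpr (ContinuousLinearMap.ext fun w => h α w)
  rwa [S.char_inf x, Submodule.mem_bot] at hu

namespace IsKKahler

variable (hK : IsKKahler S Q J g)
include hK

theorem endo_mem_Q {α : Fin k} {x : M} {u : TangentSpace (𝓡 (n * (k + 1))) x}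
    (hu : u ∈ S.L α x) : (J α).endo x u ∈ Q x := by
  rw [← hK.map_L α x]; exact Submodule.mem_map_of_mem hu

theorem endo_mem_L {α : Fin k} {x : M} {u : TangentSpace (𝓡 (n * (k + 1))) x}
    (hu : u ∈ Q x) : (J α).endo x u ∈ S.L α x := by
  rw [← hK.map_Q α x]; exact Submodule.mem_map_of_mem hu

/-- Smooth sections of `L_α` come from those of `Q` by applying `J_α`, so smoothness of `L_α`
follows from that of `Q`. -/
theorem exists_section_L {α : Fin k} {x : M} {u : TangentSpace (𝓡 (n * (k + 1))) x}
    (hu : u ∈ S.L α x) :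
    ∃ X : Field (d := n * (k + 1)) M, IsSection (S.L α) X ∧ X x = u := by
  rw [← hK.map_Q α x] at hu
  obtain ⟨w, hw, rfl⟩ := hu
  obtain ⟨Y, hY, rfl⟩ := hK.smooth.exists_section x w hw
  exact ⟨fun y => (J α).endo y (Y y),
    ⟨(J α).isSmoothField_apply hY.1, fun y => hK.endo_mem_L (hY.2 y)⟩, rfl⟩

theorem eq_zero_of_mem_F {x : M} {u : TangentSpace (𝓡 (n * (k + 1))) x} (hu : u ∈ S.F x)
    (h : ∀ α, ∀ w ∈ Q x, (S.Ω α).form x u w = 0) : u = 0 := by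
  refine S.eq_zero_of_form_eq_zero fun α w => ?_
  have hw : w ∈ S.F x ⊔ Q x := by rw [(hK.transversal x).sup_eq_top]; trivial
  obtain ⟨a, ha, b, hb, rfl⟩ := Submodule.mem_sup.mp hw
  rw [map_add, S.isotropic_F α x u hu a ha, h α b hb, add_zero]

/-- Write `u = a + b` along `TF ⊕ Q`. For `w` in `Q`, `ω_α(a, w) = g(a, J_α w)` with `J_α w` in
`L_α`, and both `u` and `b` are orthogonal to `L_α`; so `a` pairs to zero with `Q` under every
`ω_α`. No decomposition of `TF` into the `L_α` is needed. -/
theorem mem_Q_of_orthogonal {x : M} {u : TangentSpace (𝓡 (n * (k + 1))) x}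
    (h : ∀ α, ∀ w ∈ S.L α x, g.inner x u w = 0) : u ∈ Q x := by
  have hu : u ∈ S.F x ⊔ Q x := by rw [(hK.transversal x).sup_eq_top]; trivial
  obtain ⟨a, ha, b, hb, rfl⟩ := Submodule.mem_sup.mp hu
  have ha0 : a = 0 := hK.eq_zero_of_mem_F ha fun α w hw => by
    have hl := hK.endo_mem_L (α := α) hw
    have h1 := h α _ hl
    rw [map_add, add_apply, g.symm x b, hK.orthogonal_Q α x _ hl b hb,
      add_zero] at h1
    rw [hK.compatible, h1]
  rwa [ha0, zero_add]

theorem iSup_L_sup_Q (x : M) : (⨆ α, S.L α x) ⊔ Q x = ⊤ := by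
  refine eq_top_of_orthogonal_eq_zero
    (ContinuousLinearMap.coeLM ℝ ∘ₗ (g.inner x).toLinearMap) _ fun u hu => ?_
  have hQ : u ∈ Q x := hK.mem_Q_of_orthogonal fun α w hw =>
    hu w (Submodule.mem_sup_left (Submodule.mem_iSup_of_mem α hw))
  by_contra h0
  exact (g.pos x u h0).ne' (hu u (Submodule.mem_sup_right hQ))

/-- A linear map that vanishes on every `L_α` and on `Q` is zero. -/
theorem eq_zero_of_forall_mem {W : Type*} [AddCommMonoid W] [Module ℝ W] {x : M}
    (f : TangentSpace (𝓡 (n * (k + 1))) x →ₗ[ℝ] W) (hL : ∀ α, ∀ u ∈ S.L α x, f u = 0)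
    (hQ : ∀ u ∈ Q x, f u = 0) (u : TangentSpace (𝓡 (n * (k + 1))) x) : f u = 0 := by
  have h : (⨆ α, S.L α x) ⊔ Q x ≤ LinearMap.ker f :=
    sup_le (iSup_le fun α u hu => hL α u hu) fun u hu => hQ u hu
  rw [hK.iSup_L_sup_Q x] at h
  exact h trivial

/-- On `L_α` the single form `ω_α` detects vectors, since the other forms vanish there. -/
theorem eq_zero_of_mem_L {α : Fin k} {x : M} {u : TangentSpace (𝓡 (n * (k + 1))) x}
    (hu : u ∈ S.L α x) (h : ∀ w ∈ Q x, (S.Ω α).form x u w = 0) : u = 0 := by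
  refine hK.eq_zero_of_mem_F (S.L_le_F α x hu) fun β w hw => ?_
  rcases eq_or_ne β α with rfl | hβ
  · exact h w hw
  · exact (S.Ω β).form_eq_zero_of_mem_char (S.L_le_char hβ x hu) w

theorem eq_zero_of_mem_Q {x : M} {u : TangentSpace (𝓡 (n * (k + 1))) x}
    (hu : u ∈ Q x) (h : ∀ α, ∀ w ∈ S.L α x, (S.Ω α).form x u w = 0) : u = 0 := by
  refine S.eq_zero_of_form_eq_zero fun α => hK.eq_zero_of_forall_mem
    ((S.Ω α).form x u).toLinearMap (fun β w hw => ?_) fun w hw => hK.isotropic α x u hu w hw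
  rcases eq_or_ne α β with rfl | hβ
  · exact h α w hw
  · change (S.Ω α).form x u w = 0
    rw [(S.Ω α).form_swap, (S.Ω α).form_eq_zero_of_mem_char (S.L_le_char hβ x hw), neg_zero]

/-! ### The Levi-Civita connection is canonical -/

section LeviCivita

variable {cov : Connection (d := n * (k + 1)) M} (hLC : IsLeviCivita g cov)
  (hL : ∀ α, Preserves cov (S.L α))
include hLC hL

/-- Differentiating `g(X, Y) = 0` for `X` in `L_α` and `Y` in `Q` shows that `∇_v Y` is orthogonal
to `L_α`, because `∇_v X` stays in `L_α`. -/
theorem preserves_Q : Preserves cov Q := by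
  intro Y hY x v
  refine hK.mem_Q_of_orthogonal fun α w hw => ?_
  obtain ⟨X, hX, rfl⟩ := hK.exists_section_L hw
  have h0 : (fun y => g.inner y (X y) (Y y)) = 0 :=
    funext fun y => hK.orthogonal_Q α y _ (hX.2 y) _ (hY.2 y)
  have h := hLC.dirDeriv_inner hX.1 hY.1 x v
  rw [dirDeriv, h0, mvfderiv_zero, hK.orthogonal_Q α x _ (hL α X hX x v) _ (hY.2 x), zero_add] at h
  rw [g.symm, ← h]; rfl

omit hL in
/-- `∇ω_α` vanishes on `L_α × Q` in the directions of a subbundle `D` which is `L_α` or `Q`, and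
more generally on `D × J_α D` in the directions of `D`. -/
theorem derivForm_endo_eq_zero (α : Fin k) {D : Distribution (d := n * (k + 1)) M}
    (hD : Preserves cov D) (hDQ : ∀ x, D x ≤ S.LQ Q α x)
    (hiso : ∀ x, ∀ u ∈ D x, ∀ w ∈ D x, (S.Ω α).form x u w = 0)
    {X Y Z : Field (d := n * (k + 1)) M} (hX : IsSection D X) (hY : IsSection D Y)
    (hZ : IsSection D Z) (x : M) :
    derivForm cov (S.Ω α) x (X x) ((J α).endo x (Y x)) (Z x) = 0 := by
  have hsq : ∀ {U}, IsSection D U → ∀ y, (J α).endo y ((J α).endo y (U y)) = -U y :=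
    fun hU y => hK.sq_eq_neg α y _ (hDQ y (hU.2 y))
  have hskew : ∀ {U V W}, IsSection D U → IsSection D V → IsSection D W →
      derivForm cov (S.Ω α) x (U x) ((J α).endo x (V x)) (W x)
        = -derivForm cov (S.Ω α) x (V x) ((J α).endo x (U x)) (W x) := fun hU hV _ =>
    eq_neg_of_add_eq_zero_left
      (hLC.derivForm_endo_skew (hK.compatible α) hU.1 hV.1 (hsq hU) (hsq hV) x _)
  have hsymm : ∀ {U V W}, IsSection D U → IsSection D V → IsSection D W →
      derivForm cov (S.Ω α) x (U x) ((J α).endo x (V x)) (W x)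
        = derivForm cov (S.Ω α) x (W x) ((J α).endo x (V x)) (U x) := by
    intro U V W hU hV hW
    have hJV := (J α).isSmoothField_apply hV.1
    -- Of the three cyclic terms, the one with both form arguments in `D` vanishes by isotropy.
    have h1 := (S.closed α).cyclic_sum_derivForm hLC.torsion_free hW.1 hU.1 hJV x
    have h2 := derivForm_eq_zero_of_orthogonal hD hD hiso hW hU x ((J α).endo x (V x))
    have h3 := derivForm_swap cov (S.Ω α) hW.1 hJV x (U x)
    linarith
  -- Alternating the two transpositions six times returns to the initial order with three sign
  -- changes, so the quantity equals its negative.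
  have e1 := hskew hX hY hZ
  have e2 := hsymm hY hX hZ
  have e3 := hskew hZ hX hY
  have e4 := hsymm hX hZ hY
  have e5 := hskew hY hZ hX
  have e6 := hsymm hZ hY hX
  linarith

theorem isParallel (α : Fin k) : IsParallel cov (S.Ω α) := by
  have hQ := hK.preserves_Q hLC hL
  have hisoL : ∀ x, ∀ u ∈ S.L α x, ∀ w ∈ S.L α x, (S.Ω α).form x u w = 0 := fun x u hu w hw =>
    S.isotropic_F α x u (S.L_le_F α x hu) w (S.L_le_F α x hw)
  have hortho : ∀ β, β ≠ α → ∀ {X Y : Field (d := n * (k + 1)) M}, IsSection (S.L β) X →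
      IsSmoothField Y → ∀ x v, derivForm cov (S.Ω α) x (X x) (Y x) v = 0 := by
    intro β hβ X Y hX hY x v
    exact derivForm_eq_zero_of_orthogonal (D' := fun _ => ⊤) (hL β) (fun _ _ _ _ => trivial)
      (fun x u hu w _ => (S.Ω α).form_eq_zero_of_mem_char (S.L_le_char hβ.symm x hu) w) hX
      ⟨hY, fun _ => trivial⟩ x v
  have hmixed : ∀ {X Y : Field (d := n * (k + 1)) M}, IsSection (S.L α) X → IsSection Q Y →
      ∀ x v, derivForm cov (S.Ω α) x (X x) (Y x) v = 0 := by
    intro X Y hX hY x v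
    refine hK.eq_zero_of_forall_mem (derivForm cov (S.Ω α) x (X x) (Y x)).toLinearMap
      (fun β v hv => ?_) (fun v hv => ?_) v
    · obtain ⟨Z, hZ, rfl⟩ := hK.exists_section_L hv
      change derivForm cov (S.Ω α) x (X x) (Y x) (Z x) = 0
      rcases eq_or_ne β α with rfl | hβ
      -- `Y = -J(JY)` with `JY` in the same `L`, so the term has the form treated by the lemma with
      -- `D = L`.
      · have h := hK.derivForm_endo_eq_zero hLC β (hL β) (fun y => le_sup_left) hisoL hX
          (Y := fun y => (J β).endo y (Y y))
          ⟨(J β).isSmoothField_apply hY.1, fun y => hK.endo_mem_L (hY.2 y)⟩ hZ x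
        rw [hK.sq_eq_neg β x _ (Submodule.mem_sup_right (hY.2 x)), map_neg] at h
        simpa using h
      -- In the cyclic sum the other two terms have `Z` as a form argument, and `Z` lies in
      -- `C(ω_α)`.
      · have h1 := (S.closed α).cyclic_sum_derivForm hLC.torsion_free hZ.1 hX.1 hY.1 x
        have h2 := derivForm_swap cov (S.Ω α) hY.1 hZ.1 x (X x)
        have h3 := hortho β hβ hZ hY.1 x (X x)
        have h4 := hortho β hβ hZ hX.1 x (Y x)
        linarith
    · obtain ⟨Z, hZ, rfl⟩ := hK.smooth.exists_section x v hv
      change derivForm cov (S.Ω α) x (X x) (Y x) (Z x) = 0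
      -- Now `D = Q`, with the roles of `X` and `Y` exchanged and `X = -J(JX)`.
      have h := hK.derivForm_endo_eq_zero hLC α hQ (fun y => le_sup_right) (hK.isotropic α) hY
          (Y := fun y => (J α).endo y (X y))
          ⟨(J α).isSmoothField_apply hX.1, fun y => hK.endo_mem_Q (hX.2 y)⟩ hZ x
      rw [hK.sq_eq_neg α x _ (Submodule.mem_sup_left (hX.2 x)), map_neg] at h
      rw [derivForm_swap cov _ hX.1 hY.1, neg_eq_zero]
      simpa using h
  refine isParallel_of_derivForm_eq_zero fun x => ContinuousLinearMap.ext fun u =>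
    hK.eq_zero_of_forall_mem (derivForm cov (S.Ω α) x).toLinearMap (fun β u hu => ?_)
      (fun u hu => ?_) u
  · obtain ⟨X, hX, rfl⟩ := hK.exists_section_L hu
    refine ContinuousLinearMap.ext fun w => hK.eq_zero_of_forall_mem
      (derivForm cov (S.Ω α) x (X x)).toLinearMap (fun γ w hw => ?_) (fun w hw => ?_) w
    · obtain ⟨Y, hY, rfl⟩ := hK.exists_section_L hw
      refine ContinuousLinearMap.ext fun v => ?_
      change derivForm cov (S.Ω α) x (X x) (Y x) v = 0
      rcases eq_or_ne β α with rfl | hβ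
      · rcases eq_or_ne γ β with rfl | hγ
        · exact derivForm_eq_zero_of_orthogonal (hL γ) (hL γ) hisoL hX hY x v
        · rw [derivForm_swap cov _ hX.1 hY.1, hortho γ hγ hY hX.1, neg_zero]
      · exact hortho β hβ hX hY.1 x v
    · obtain ⟨Y, hY, rfl⟩ := hK.smooth.exists_section x w hw
      refine ContinuousLinearMap.ext fun v => ?_
      change derivForm cov (S.Ω α) x (X x) (Y x) v = 0
      rcases eq_or_ne β α with rfl | hβ
      · exact hmixed hX hY x v
      · exact hortho β hβ hX hY.1 x v
  · obtain ⟨X, hX, rfl⟩ := hK.smooth.exists_section x u hu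
    refine ContinuousLinearMap.ext fun w => hK.eq_zero_of_forall_mem
      (derivForm cov (S.Ω α) x (X x)).toLinearMap (fun γ w hw => ?_) (fun w hw => ?_) w
    · obtain ⟨Y, hY, rfl⟩ := hK.exists_section_L hw
      refine ContinuousLinearMap.ext fun v => ?_
      change derivForm cov (S.Ω α) x (X x) (Y x) v = 0
      rw [derivForm_swap cov _ hX.1 hY.1, neg_eq_zero]
      rcases eq_or_ne γ α with rfl | hγ
      · exact hmixed hY hX x v
      · exact hortho γ hγ hY hX.1 x v
    · obtain ⟨Y, hY, rfl⟩ := hK.smooth.exists_section x w hw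
      exact ContinuousLinearMap.ext fun v =>
        derivForm_eq_zero_of_orthogonal hQ hQ (hK.isotropic α) hX hY x v

theorem isCanonicalConnection : IsCanonicalConnection S Q cov where
  smooth := hLC.smooth
  preserves_L := hL
  preserves_Q := hK.preserves_Q hLC hL
  parallel := hK.isParallel hLC hL
  torsion x v _ w _ := by rw [hLC.torsion_free]; rfl

end LeviCivita

end IsKKahler

/-! ### Uniqueness of the canonical connection -/

theorem difference_apply_section (cov cov' : Connection (d := n * (k + 1)) M)
    {X : Field (d := n * (k + 1)) M} (hX : IsSmoothField X) (x : M) :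
    cov.difference cov' x (X x) = cov X x - cov' X x :=
  IsCovariantDerivativeOn.difference_apply _ _ (hσ := hX.mdifferentiableAt x)

/-- The difference of two connections for which `η` is parallel is skew for `η`. -/
theorem form_difference_add {cov cov' : Connection (d := n * (k + 1)) M}
    {η : TwoForm (d := n * (k + 1)) M} (h : IsParallel cov η) (h' : IsParallel cov' η)
    {X Y : Field (d := n * (k + 1)) M} (hX : IsSmoothField X) (hY : IsSmoothField Y) (x : M)
    (v : TangentSpace (𝓡 (n * (k + 1))) x) :
    η.form x (cov.difference cov' x (X x) v) (Y x)
      + η.form x (X x) (cov.difference cov' x (Y x) v) = 0 := by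
  rw [difference_apply_section cov cov' hX, difference_apply_section cov cov' hY]
  have h1 := h X Y hX hY x v
  have h2 := h' X Y hX hY x v
  simp only [sub_apply, map_sub]
  linarith

/-- The canonical connection is unique. -/
theorem IsCanonicalConnection.coincide (hK : IsKKahler S Q J g)
    {cov cov' : Connection (d := n * (k + 1)) M} (h : IsCanonicalConnection S Q cov)
    (h' : IsCanonicalConnection S Q cov') : Coincide cov cov' := by
  -- In `cov.difference cov' x u v` the direction of differentiation is `v`; the subbundle is the
  -- one containing `u`.
  have memL : ∀ {α X}, IsSection (S.L α) X → ∀ x v, cov.difference cov' x (X x) v ∈ S.L α x := by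
    intro α X hX x v
    rw [difference_apply_section cov cov' hX.1]
    exact Submodule.sub_mem _ (h.preserves_L α X hX x v) (h'.preserves_L α X hX x v)
  have memQ : ∀ {Y}, IsSection Q Y → ∀ x v, cov.difference cov' x (Y x) v ∈ Q x := by
    intro Y hY x v
    rw [difference_apply_section cov cov' hY.1]
    exact Submodule.sub_mem _ (h.preserves_Q Y hY x v) (h'.preserves_Q Y hY x v)
  have hsymm : ∀ {α X Y}, IsSection (S.L α) X → IsSection Q Y → ∀ x,
      cov.difference cov' x (Y x) (X x) = cov.difference cov' x (X x) (Y x) := by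
    intro α X Y hX hY x
    have e1 := bracket_eq_of_torsion_eq_zero hX.1 hY.1
      (h.torsion x _ (S.L_le_F α x (hX.2 x)) _ (hY.2 x))
    have e2 := bracket_eq_of_torsion_eq_zero hX.1 hY.1
      (h'.torsion x _ (S.L_le_F α x (hX.2 x)) _ (hY.2 x))
    rw [difference_apply_section cov cov' hX.1, difference_apply_section cov cov' hY.1]
    rw [e1] at e2
    simp only [sub_apply]
    exact sub_eq_sub_iff_sub_eq_sub.mp e2
  -- By symmetry the same vector lies in `Q` and in `L_α ⊂ TF`, which meet only in zero.
  have hQL : ∀ {α X Y}, IsSection (S.L α) X → IsSection Q Y → ∀ x,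
      cov.difference cov' x (Y x) (X x) = 0 := fun {α X Y} hX hY x =>
    Submodule.disjoint_def.mp (hK.transversal x).disjoint _
      (S.L_le_F α x (hsymm hX hY x ▸ memL hX x (Y x))) (memQ hY x (X x))
  have hLQ : ∀ {α X Y}, IsSection (S.L α) X → IsSection Q Y → ∀ x,
      cov.difference cov' x (X x) (Y x) = 0 := fun hX hY x => hsymm hX hY x ▸ hQL hX hY x
  have hzero : ∀ x u, cov.difference cov' x u = 0 := by
    intro x u
    refine hK.eq_zero_of_forall_mem (cov.difference cov' x).toLinearMap (fun α u hu => ?_)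
      (fun u hu => ?_) u
    · obtain ⟨X, hX, rfl⟩ := hK.exists_section_L hu
      refine ContinuousLinearMap.ext fun v => hK.eq_zero_of_forall_mem
        (cov.difference cov' x (X x)).toLinearMap (fun β v hv => ?_) (fun v hv => ?_) v
      · obtain ⟨Z, hZ, rfl⟩ := hK.exists_section_L hv
        refine hK.eq_zero_of_mem_L (memL hX x (Z x)) fun w hw => ?_
        obtain ⟨Y, hY, rfl⟩ := hK.smooth.exists_section x w hw
        -- Skewness moves the difference tensor onto `Y`, where it is a mixed term and vanishes.
        have e := form_difference_add (h.parallel α) (h'.parallel α) hX.1 hY.1 x (Z x)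
        rwa [hQL hZ hY, map_zero, add_zero] at e
      · obtain ⟨Z, hZ, rfl⟩ := hK.smooth.exists_section x v hv
        exact hLQ hX hZ x
    · obtain ⟨Y, hY, rfl⟩ := hK.smooth.exists_section x u hu
      refine ContinuousLinearMap.ext fun v => hK.eq_zero_of_forall_mem
        (cov.difference cov' x (Y x)).toLinearMap (fun β v hv => ?_) (fun v hv => ?_) v
      · obtain ⟨Z, hZ, rfl⟩ := hK.exists_section_L hv
        exact hQL hZ hY x
      · obtain ⟨Z, hZ, rfl⟩ := hK.smooth.exists_section x v hv
        refine hK.eq_zero_of_mem_Q (memQ hY x (Z x)) fun α w hw => ?_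
        obtain ⟨X, hX, rfl⟩ := hK.exists_section_L hw
        have e := form_difference_add (h.parallel α) (h'.parallel α) hY.1 hX.1 x (Z x)
        rwa [hLQ hX hZ, map_zero, add_zero] at e
  -- The difference is a tensor, so its vanishing, tested on smooth sections, covers fields
  -- differentiable only at `x`.
  intro Y x hY
  have e : cov.difference cov' x (Y x) = cov Y x - cov' Y x :=
    IsCovariantDerivativeOn.difference_apply _ _ (hσ := hY)
  rw [hzero] at e
  exact (sub_eq_zero.mp e.symm)

end KSymp

end KSymplectic

end

theorem mainTheorem5 (n k : ℕ) (M : Type*) [TopologicalSpace M] [T2Space M] [SigmaCompactSpace M]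
    [ChartedSpace (EuclideanSpace ℝ (Fin (n * (k + 1)))) M]
    [IsManifold (𝓡 (n * (k + 1))) ∞ M]
    (S : KSymplectic.KSymplecticStructure n k M)
    (Q : KSymplectic.Distribution (d := n * (k + 1)) M)
    (J : Fin k → KSymplectic.EndoField (d := n * (k + 1)) M)
    (g : KSymplectic.Metric (d := n * (k + 1)) M)
    (hK : KSymplectic.IsKKahler S Q J g)
    (nablaG : KSymplectic.Connection (d := n * (k + 1)) M)
    (hLC : KSymplectic.IsLeviCivita g nablaG)
    (hL : ∀ α, KSymplectic.Preserves nablaG (S.L α)) :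
    KSymplectic.Preserves nablaG Q ∧
      KSymplectic.IsCanonicalConnection S Q nablaG ∧
      ∀ nabla : KSymplectic.Connection (d := n * (k + 1)) M,
        KSymplectic.IsCanonicalConnection S Q nabla → KSymplectic.Coincide nablaG nabla := by
  exact ⟨hK.preserves_Q hLC hL, hK.isCanonicalConnection hLC hL, fun _ h =>
    (hK.isCanonicalConnection hLC hL).coincide hK h⟩
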